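/- A *temporal graph* $\mathcal G=(G,\mathcal T)$ is a finite simple graph $G=(V,E)$ together with a map $\mathcal T:E\to 2^{\mathbb Z^+}\setminus\{\emptyset\}$ assigning to each edge its set of appearance times, such that there is a largest time $T(\mathcal G)$ at which any edge appears (put $T(\mathcal G)=0$ if $E=\emptyset$). A pair $(e,t)$ with $e\in E$, $t\in\mathcal T(e)$ is a *time-edge*. For $S\subseteq V$, $\mathcal G[S]$ is the temporal graph with vertex set $S$ whose time-edges are those of $\mathcal G$ with both endpoints in $S$. An *interval* is $[a,b]=\{a,a+1,\dots,b\}$ with $a\le b$ in $\mathbb N$. For $\Delta_1\ge 1$, an edge $e\in E$ is *$\Delta_1$-dense* in $[a,b]$ if for every integer $\tau\in[a,\max\{a,b-\Delta_1+1\}]$ there is $t\in\mathcal T(e)$ with $\tau\le t\le\tau+\Delta_1-1$ (a non-edge is never $\Delta_1$-dense). A *template* on $V$ is a pair $(X,[a,b])$ with $X\subseteq V$ and $[a,b]$ an interval. Templates $(X,[a,b])$ and $(Y,[c,d])$ are *$\Delta_2$-independent* if $X\cap Y=\emptyset$ or $\min_{s\in[a,b],\,t\in[c,d]}|s-t|\ge\Delta_2$.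 The temporal graph $\mathcal G$ is a *$(\Delta_1,\Delta_2)$-cluster temporal graph* if there is a finite set $\{(X_i,[a_i,b_i])\}_{i\in[k]}$ of pairwise $\Delta_2$-independent templates on $V$ with $1\le a_i\le b_i\le T(\mathcal G)$ such that - for every time-edge $(xy,t)$ of $\mathcal G$ there is $i\in[k]$ with $x,y\in X_i$ and $t\in[a_i,b_i]$, and - for every $i\in[k]$ and all distinct $x,y\in X_i$, the pair $xy$ is an edge that is $\Delta_1$-dense in $[a_i,b_i]$. **Theorem.** Let $\mathcal G$ be any temporal graph, and let $\Delta_2>\Delta_1\ge 1$ be integers. Then the following holds. - If $\Delta_1=1$, then $\mathcal G$ is a $(1,\Delta_2)$-cluster temporal graph if and only if $\mathcal G[S]$ is a $(1,\Delta_2)$-cluster temporal graph for every set $S\subseteq V$ of at most $3$ vertices. - If $\Delta_1>1$, then $\mathcal G$ is a $(\Delta_1,\Delta_2)$-cluster temporal graph if and only if $\mathcal G[S]$ is a $(\Delta_1,\Delta_2)$-cluster temporal graph for every set $S\subseteq V$ of at most $5$ vertices. -/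

import Mathlib

/-- A temporal graph on the vertex set `V`: a static simple graph together with a labelling of its
edges by non-empty sets of positive integers, of finite lifetime. The labelling is extended by the
empty set to the unordered pairs that are not edges. -/
structure TemporalGraph (V : Type*) where
  /-- the underlying static graph -/
  graph : SimpleGraph V
  /-- the set of times at which an edge appears -/
  times : Sym2 V → Set ℕ
  times_nonempty_iff : ∀ e, (times e).Nonempty ↔ e ∈ graph.edgeSet
  times_pos : ∀ e, ∀ t ∈ times e, 1 ≤ t
  finite_lifetime : ∃ T, ∀ e, ∀ t ∈ times e, t ≤ T

/-- A template `(X, [a, b])`: a set of vertices and an interval of natural numbers with `a ≤ b`. -/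
@[ext]
structure Template (V : Type*) where
  verts : Set V
  a : ℕ
  b : ℕ
  a_le_b : a ≤ b

/-- Two templates are `Δ₂`-independent if their vertex sets are disjoint, or any time of the one
interval has distance at least `Δ₂` from any time of the other. -/
def Template.Independent {V : Type*} (Δ₂ : ℕ) (C D : Template V) : Prop :=
  C.verts ∩ D.verts = ∅ ∨
    ∀ s ∈ Set.Icc C.a C.b, ∀ t ∈ Set.Icc D.a D.b, (Δ₂ : ℤ) ≤ |(s : ℤ) - (t : ℤ)|

namespace TemporalGraph

variable {V : Type*}

/-- The lifetime: the largest time at which an edge appears (`0` if there is no edge). -/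
noncomputable def lifetime (G : TemporalGraph V) : ℕ :=
  sSup {t | ∃ e, t ∈ G.times e}

/-- The temporal graph `G[A]` with vertex set `A` and all time-edges of `G` with both ends
in `A`. -/
def induce (G : TemporalGraph V) (A : Set V) : TemporalGraph A where
  graph := G.graph.induce A
  times e := G.times (e.map Subtype.val)
  times_nonempty_iff e := by
    induction e with
    | _ x y => simp [G.times_nonempty_iff]
  times_pos e t ht := G.times_pos _ t ht
  finite_lifetime := G.finite_lifetime.imp fun _ hT e t ht => hT _ t ht

/-- `e` is `Δ₁`-dense in `[a, b]`: for all `τ ∈ [a, max {a, b - Δ₁ + 1}]` the edge `e` appears at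
some time in `[τ, τ + Δ₁ - 1]`. The upper end is written `b + 1 - Δ₁` because
natural subtraction truncates. -/
def DenseIn (G : TemporalGraph V) (Δ₁ : ℕ) (e : Sym2 V) (a b : ℕ) : Prop :=
  ∀ τ ∈ Set.Icc a (max a (b + 1 - Δ₁)), ∃ t ∈ G.times e, t ∈ Set.Icc τ (τ + Δ₁ - 1)

/-- The (finite) collections of pairwise `Δ₂`-independent templates on the vertex set of `G` whose
intervals `[a, b]` satisfy `1 ≤ a ≤ b ≤ T(G)`. -/
def templateCollections (G : TemporalGraph V) (Δ₂ : ℕ) : Set (Set (Template V)) :=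
  {𝒞 | 𝒞.Finite ∧ 𝒞.Pairwise (Template.Independent Δ₂) ∧
    ∀ C ∈ 𝒞, 1 ≤ C.a ∧ C.b ≤ G.lifetime}

/-- `G` realises the collection `𝒞`: every time-edge is covered by a template of `𝒞`, and in every
template all pairs of (distinct) vertices are `Δ₁`-dense in the interval of the template. -/
def Realises (G : TemporalGraph V) (Δ₁ : ℕ) (𝒞 : Set (Template V)) : Prop :=
  (∀ x y t, t ∈ G.times s(x, y) →
    ∃ C ∈ 𝒞, x ∈ C.verts ∧ y ∈ C.verts ∧ t ∈ Set.Icc C.a C.b) ∧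
  ∀ C ∈ 𝒞, ∀ x ∈ C.verts, ∀ y ∈ C.verts, x ≠ y → G.DenseIn Δ₁ s(x, y) C.a C.b

/-- `G` is a `(Δ₁, Δ₂)`-cluster temporal graph. -/
def IsCluster (G : TemporalGraph V) (Δ₁ Δ₂ : ℕ) : Prop :=
  ∃ 𝒞 ∈ G.templateCollections Δ₂, G.Realises Δ₁ 𝒞

end TemporalGraph

/-! For sufficiency, take all maximal tight templates. The heart is absorption (`IsTight.extend`): a
tight template can be enlarged by any incident time-edge less than `Δ₂` away, since covers of small
sets force the new pairs to be nearly dense. A maximal template therefore already contains every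
such time-edge. This turns near density into density (`IsMaxTight.denseIn`) and keeps maximal
templates with a common vertex `Δ₂` apart (`IsMaxTight.independent`).

Five vertices occur as three vertices under study together with a time-edge fixing a moment, or as a
common vertex with two time-edges. If `Δ₁ = 1`, near density at a moment means appearing then, so
three vertices suffice.

Necessity follows from sufficiency: covers, unlike realised collections, restrict to `G[S]`. -/

namespace TemporalGraph

variable {V : Type*}

/-! ### Near density and covers. -/

/-- A form of `Δ`-density that passes to subintervals: every subinterval `[u, w]` of `[a, b]` with
at most `Δ` elements lies in a window of `Δ` consecutive times during which `e` appears. -/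
def NearDenseIn (G : TemporalGraph V) (Δ : ℕ) (e : Sym2 V) (a b : ℕ) : Prop :=
  ∀ u w, a ≤ u → u ≤ w → w ≤ b → w < u + Δ → ∃ t ∈ G.times e, w < t + Δ ∧ t < u + Δ

/-- `𝒞` covers all time-edges inside `S` by nearly dense templates, and two templates of `𝒞`
coincide if they share a vertex and contain times less than `Δ₂` apart. -/
structure IsCover (G : TemporalGraph V) (Δ₁ Δ₂ : ℕ) (S : Set V) (𝒞 : Set (Template V)) :
    Prop where
  unique : ∀ C ∈ 𝒞, ∀ D ∈ 𝒞, ∀ v s t, v ∈ C.verts → v ∈ D.verts → s ∈ Set.Icc C.a C.b →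
    t ∈ Set.Icc D.a D.b → s < t + Δ₂ → t < s + Δ₂ → C = D
  cover : ∀ x ∈ S, ∀ y ∈ S, ∀ t ∈ G.times s(x, y),
    ∃ C ∈ 𝒞, x ∈ C.verts ∧ y ∈ C.verts ∧ t ∈ Set.Icc C.a C.b
  dense : ∀ C ∈ 𝒞, ∀ x ∈ C.verts, ∀ y ∈ C.verts, x ≠ y → G.NearDenseIn Δ₁ s(x, y) C.a C.b

/-- Small vertex sets have covers: all sets of at most three vertices if `Δ₁ = 1`, and all sets of
at most five vertices in general. -/
def LocallyCovered (G : TemporalGraph V) (Δ₁ Δ₂ : ℕ) : Prop :=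
  (Δ₁ = 1 ∧ ∀ x y z, ∃ 𝒞, G.IsCover Δ₁ Δ₂ {x, y, z} 𝒞) ∨
    ∀ x y z u v, ∃ 𝒞, G.IsCover Δ₁ Δ₂ {x, y, z, u, v} 𝒞

/-- A template containing time-edges at both ends of its interval, all of whose pairs are nearly
dense. -/
structure IsTight (G : TemporalGraph V) (Δ : ℕ) (C : Template V) : Prop where
  left : ∃ x ∈ C.verts, ∃ y ∈ C.verts, C.a ∈ G.times s(x, y)
  right : ∃ x ∈ C.verts, ∃ y ∈ C.verts, C.b ∈ G.times s(x, y)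
  dense : ∀ x ∈ C.verts, ∀ y ∈ C.verts, x ≠ y → G.NearDenseIn Δ s(x, y) C.a C.b

variable {G : TemporalGraph V} {Δ Δ₁ Δ₂ : ℕ} {S : Set V} {𝒞 : Set (Template V)}

theorem ne_of_mem_times {x y : V} {t : ℕ} (h : t ∈ G.times s(x, y)) : x ≠ y := by
  rintro rfl
  exact ((G.times_nonempty_iff _).1 ⟨t, h⟩).ne rfl

theorem NearDenseIn.mono {e : Sym2 V} {a b c d : ℕ} (h : G.NearDenseIn Δ e a b) (hac : a ≤ c)
    (hdb : d ≤ b) : G.NearDenseIn Δ e c d :=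
  fun u w hu huw hw hlt => h u w (hac.trans hu) huw (hw.trans hdb) hlt

theorem NearDenseIn.exists_near {e : Sym2 V} {a b s : ℕ} (h : G.NearDenseIn Δ e a b) (hΔ : 1 ≤ Δ)
    (ha : a ≤ s) (hb : s ≤ b) : ∃ t ∈ G.times e, s < t + Δ ∧ t < s + Δ :=
  h s s ha le_rfl hb (by omega)

theorem DenseIn.nearDenseIn {e : Sym2 V} {a b : ℕ} (h : G.DenseIn Δ e a b) :
    G.NearDenseIn Δ e a b := by
  intro u w hu huw hw hlt
  obtain ⟨t, ht, h1, h2⟩ := h (min u (max a (b + 1 - Δ))) ⟨by omega, by omega⟩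
  exact ⟨t, ht, by omega, by omega⟩

namespace IsCover

theorem mono {S' : Set V} (h : G.IsCover Δ₁ Δ₂ S 𝒞) (hS : S' ⊆ S) : G.IsCover Δ₁ Δ₂ S' 𝒞 :=
  ⟨h.unique, fun x hx y hy => h.cover x (hS hx) y (hS hy), h.dense⟩

/-- A time-edge incident with a template and less than `Δ₂` away from it is in the template. -/
theorem mem_of_close (h : G.IsCover Δ₁ Δ₂ S 𝒞) {C : Template V} (hC : C ∈ 𝒞) {x y : V} {s t : ℕ}
    (hx : x ∈ S) (hy : y ∈ S) (hxC : x ∈ C.verts) (hs : s ∈ Set.Icc C.a C.b)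
    (ht : t ∈ G.times s(x, y)) (h1 : s < t + Δ₂) (h2 : t < s + Δ₂) :
    y ∈ C.verts ∧ t ∈ Set.Icc C.a C.b := by
  obtain ⟨D, hD, hxD, hyD, htD⟩ := h.cover x hx y hy t ht
  obtain rfl := h.unique C hC D hD x s t hxC hxD hs htD h1 h2
  exact ⟨hyD, htD⟩

/-- Near density gives an appearance of `xy` less than `Δ₁ < Δ₂` from `s`, which `C` absorbs. -/
theorem mem_of_nearDenseIn (h : G.IsCover Δ₁ Δ₂ S 𝒞) (h1 : 1 ≤ Δ₁) (h2 : Δ₁ < Δ₂)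
    {C : Template V} (hC : C ∈ 𝒞) {x y : V} {a b s : ℕ} (hx : x ∈ S) (hy : y ∈ S)
    (hd : G.NearDenseIn Δ₁ s(x, y) a b) (ha : a ≤ s) (hb : s ≤ b)
    (hxC : x ∈ C.verts) (hs : s ∈ Set.Icc C.a C.b) : y ∈ C.verts := by
  obtain ⟨t, ht, ht1, ht2⟩ := hd.exists_near h1 ha hb
  exact (h.mem_of_close hC hx hy hxC hs ht (by omega) (by omega)).1

/-- While `t` is far, `xy` appears at some `r` with `s < r ≤ s + Δ₁`; `C` absorbs it, so `s` can
move up to `r`. The number `n` bounds the remaining distance. -/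
theorem eq_of_nearDenseIn_of_le (h : G.IsCover Δ₁ Δ₂ S 𝒞) (h1 : 1 ≤ Δ₁) (h2 : Δ₁ < Δ₂)
    {x y : V} {a b : ℕ} (hx : x ∈ S) (hy : y ∈ S) (hd : G.NearDenseIn Δ₁ s(x, y) a b)
    {D : Template V} (hD : D ∈ 𝒞) {t : ℕ} (htb : t ≤ b) (ht : t ∈ Set.Icc D.a D.b)
    (hxD : x ∈ D.verts) (n : ℕ) :
    ∀ {C : Template V}, C ∈ 𝒞 → ∀ {s : ℕ}, a ≤ s → s ≤ t → t - s ≤ n → s ∈ Set.Icc C.a C.b →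
      x ∈ C.verts → C = D := by
  induction n with
  | zero =>
    intro C hC s has hst hn hs hxC
    exact h.unique C hC D hD x s t hxC hxD hs ht (by omega) (by omega)
  | succ n ih =>
    intro C hC s has hst hn hs hxC
    by_cases hlt : t < s + Δ₂
    · exact h.unique C hC D hD x s t hxC hxD hs ht (by omega) hlt
    · obtain ⟨r, hr, hr1, hr2⟩ := hd (s + 1) (s + Δ₁) (by omega) (by omega) (by omega) (by omega)
      exact ih hC (by omega) (by omega) (by omega)
        (h.mem_of_close hC hx hy hxC hs hr (by omega) (by omega)).2 hxC

/-- If `xy` is nearly dense in `[a, b]`, then the templates at `x` during `[a, b]` coincide. -/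
theorem eq_of_nearDenseIn (h : G.IsCover Δ₁ Δ₂ S 𝒞) (h1 : 1 ≤ Δ₁) (h2 : Δ₁ < Δ₂)
    {x y : V} {a b : ℕ} (hx : x ∈ S) (hy : y ∈ S) (hd : G.NearDenseIn Δ₁ s(x, y) a b)
    {C D : Template V} (hC : C ∈ 𝒞) (hD : D ∈ 𝒞) {s t : ℕ} (hs : s ∈ Set.Icc a b)
    (ht : t ∈ Set.Icc a b) (hsC : s ∈ Set.Icc C.a C.b) (htD : t ∈ Set.Icc D.a D.b)
    (hxC : x ∈ C.verts) (hxD : x ∈ D.verts) : C = D := by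
  rcases le_total s t with hst | hst
  · exact h.eq_of_nearDenseIn_of_le h1 h2 hx hy hd hD ht.2 htD hxD _ hC hs.1 hst le_rfl hsC hxC
  · exact (h.eq_of_nearDenseIn_of_le h1 h2 hx hy hd hC hs.2 hsC hxC _ hD ht.1 hst le_rfl htD
      hxD).symm

/-- Near density of `xy` extends over a template containing `x`, `y` and an end of the interval. -/
theorem extend_right (h : G.IsCover Δ₁ Δ₂ S 𝒞) (h2 : Δ₁ < Δ₂)
    {x y : V} {a b t : ℕ} (hx : x ∈ S) (hy : y ∈ S) (hxy : x ≠ y)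
    (hd : G.NearDenseIn Δ₁ s(x, y) a b) {C : Template V} (hC : C ∈ 𝒞) (hxC : x ∈ C.verts)
    (hyC : y ∈ C.verts) (hb : b ∈ Set.Icc C.a C.b) (ht : t ∈ Set.Icc C.a C.b) :
    G.NearDenseIn Δ₁ s(x, y) a t := by
  intro u w hu huw hw hlt
  rcases le_or_gt w b with hwb | hwb
  · exact hd u w hu huw hwb hlt
  rcases le_or_gt b u with hbu | hbu
  · exact h.dense C hC x hxC y hyC hxy u w (hb.1.trans hbu) huw (hw.trans ht.2) hlt
  obtain ⟨r, hr, hr1, hr2⟩ := hd u b hu hbu.le le_rfl (by omega)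
  rcases lt_or_ge w (r + Δ₁) with hwr | hwr
  · exact ⟨r, hr, hwr, hr2⟩
  -- Here `r ≤ w - Δ₁ < u`, so `r` in `C` puts the whole of `[u, w]` inside `C`.
  have hrC := (h.mem_of_close hC hx hy hxC hb hr (by omega) (by omega)).2
  exact h.dense C hC x hxC y hyC hxy u w (by have := hrC.1; omega) huw (hw.trans ht.2) hlt

/-- The mirror image of `extend_right`. -/
theorem extend_left (h : G.IsCover Δ₁ Δ₂ S 𝒞) (h2 : Δ₁ < Δ₂)
    {x y : V} {a b t : ℕ} (hx : x ∈ S) (hy : y ∈ S) (hxy : x ≠ y)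
    (hd : G.NearDenseIn Δ₁ s(x, y) a b) {C : Template V} (hC : C ∈ 𝒞) (hxC : x ∈ C.verts)
    (hyC : y ∈ C.verts) (ha : a ∈ Set.Icc C.a C.b) (ht : t ∈ Set.Icc C.a C.b) :
    G.NearDenseIn Δ₁ s(x, y) t b := by
  intro u w hu huw hw hlt
  rcases le_or_gt a u with hwb | hwb
  · exact hd u w hwb huw hw hlt
  rcases le_or_gt w a with hbu | hbu
  · exact h.dense C hC x hxC y hyC hxy u w (ht.1.trans hu) huw (hbu.trans ha.2) hlt
  obtain ⟨r, hr, hr1, hr2⟩ := hd a w le_rfl hbu.le hw (by omega)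
  rcases lt_or_ge r (u + Δ₁) with hwr | hwr
  · exact ⟨r, hr, hr1, hwr⟩
  have hrC := (h.mem_of_close hC hx hy hxC ha hr (by omega) (by omega)).2
  exact h.dense C hC x hxC y hyC hxy u w (ht.1.trans hu) huw (by have := hrC.2; omega) hlt

/-- If `xp` is nearly dense in `[a, b]`, and `p`, `q`, `x` lie in templates reaching to `a` and to
`b` in two covers, then `pq` is nearly dense in `[a, b]`. -/
theorem nearDenseIn_of_two {S' : Set V} {𝒞' : Set (Template V)} (h : G.IsCover Δ₁ Δ₂ S 𝒞)
    (h' : G.IsCover Δ₁ Δ₂ S' 𝒞') (h1 : 1 ≤ Δ₁) (h2 : Δ₁ < Δ₂) {x p q : V} {a b : ℕ}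
    (hx : x ∈ S) (hp : p ∈ S) (hq : q ∈ S) (hx' : x ∈ S') (hp' : p ∈ S') (hpq : p ≠ q)
    (hd : G.NearDenseIn Δ₁ s(x, p) a b) {C C' : Template V} (hC : C ∈ 𝒞) (hC' : C' ∈ 𝒞')
    (hxC : x ∈ C.verts) (hpC : p ∈ C.verts) (hqC : q ∈ C.verts)
    (hxC' : x ∈ C'.verts) (hpC' : p ∈ C'.verts) (hqC' : q ∈ C'.verts)
    (ha : a ∈ Set.Icc C.a C.b) (hb : b ∈ Set.Icc C'.a C'.b) :
    G.NearDenseIn Δ₁ s(p, q) a b := by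
  have hCb : C.b ∈ Set.Icc C.a C.b := ⟨C.a_le_b, le_rfl⟩
  have hCa' : C'.a ∈ Set.Icc C'.a C'.b := ⟨le_rfl, C'.a_le_b⟩
  have ha1 := ha.1
  have ha2 := ha.2
  have hb1 := hb.1
  have hb2 := hb.2
  intro u w hu huw hw hlt
  rcases le_or_gt w C.b with hwC | hwC
  · exact h.dense C hC p hpC q hqC hpq u w (by omega) huw hwC hlt
  rcases le_or_gt C'.a u with huC | huC
  · exact h'.dense C' hC' p hpC' q hqC' hpq u w huC huw (by omega) hlt
  -- The window now leaves both templates. The appearances of `xp` force it to meet both intervals,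
  -- and these to overlap.
  have hur : u ≤ C.b := by
    by_contra! hr
    rcases le_or_gt (C.b + Δ₁) b with hle | hle
    · obtain ⟨r, hr, hr1, hr2⟩ := hd (C.b + 1) (C.b + Δ₁) (by omega) (by omega) hle (by omega)
      have := (h.mem_of_close hC hx hp hxC hCb hr (by omega) (by omega)).2.2
      omega
    · obtain ⟨r, hr, hr1, hr2⟩ := hd C.b b ha2 (by omega) le_rfl hle
      have := (h.mem_of_close hC hx hp hxC hCb hr (by omega) (by omega)).2.2
      have := (h'.mem_of_close hC' hx' hp' hxC' hb hr (by omega) (by omega)).2.1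
      omega
  have hcw : C'.a ≤ w := by
    by_contra! hr
    rcases le_or_gt (a + Δ₁) C'.a with hle | hle
    · obtain ⟨r, hr, hr1, hr2⟩ :=
        hd (C'.a - Δ₁) (C'.a - 1) (by omega) (by omega) (by omega) (by omega)
      have := (h'.mem_of_close hC' hx' hp' hxC' hCa' hr (by omega) (by omega)).2.1
      omega
    · obtain ⟨r, hr, hr1, hr2⟩ := hd a C'.a le_rfl (by omega) hb1 hle
      have := (h'.mem_of_close hC' hx' hp' hxC' hCa' hr (by omega) (by omega)).2.1
      have := (h.mem_of_close hC hx hp hxC ha hr (by omega) (by omega)).2.2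
      omega
  obtain ⟨r, hr, hr1, hr2⟩ := hd u w hu huw hw hlt
  have hrC := (h.mem_of_close hC hx hp hxC hCb hr (by omega) (by omega)).2.2
  have hrC' := (h'.mem_of_close hC' hx' hp' hxC' hCa' hr (by omega) (by omega)).2.1
  obtain ⟨t, ht, ht1, ht2⟩ :=
    h'.dense C' hC' p hpC' q hqC' hpq C'.a w le_rfl hcw (by omega) (by omega)
  -- If `t ≥ u + Δ₁`, then `t > w > C.b`; but `t < C'.a + Δ₁ ≤ C.b + Δ₁`, so `C` would absorb `t`.
  refine ⟨t, ht, ht1, ?_⟩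
  by_contra! hut
  have := (h.mem_of_close hC hp hq hpC hCb ht (by omega) (by omega)).2.2
  omega

end IsCover

/-! ### Using the local hypothesis around a time-edge. -/

/-- For a pair `xp` nearly dense around an occupied time `s`, some cover of `{x, p, q}` has a
template containing `x`, `p` and `s`. -/
theorem LocallyCovered.exists_template (hG : G.LocallyCovered Δ₁ Δ₂) (h1 : 1 ≤ Δ₁) (h2 : Δ₁ < Δ₂)
    {x p u v : V} (q : V) {s : ℕ} (hxp : G.NearDenseIn Δ₁ s(x, p) s s) (hs : s ∈ G.times s(u, v))
    (hux : u ≠ x → G.NearDenseIn Δ₁ s(u, x) s s) :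
    ∃ 𝒞, G.IsCover Δ₁ Δ₂ {x, p, q} 𝒞 ∧
      ∃ C ∈ 𝒞, x ∈ C.verts ∧ p ∈ C.verts ∧ s ∈ Set.Icc C.a C.b := by
  rcases hG with ⟨rfl, hG⟩ | hG
  · obtain ⟨𝒞, h⟩ := hG x p q
    obtain ⟨t, ht, ht1, ht2⟩ := hxp.exists_near le_rfl le_rfl le_rfl
    obtain rfl : t = s := by omega
    exact ⟨𝒞, h, h.cover x (by simp) p (by simp) t ht⟩
  · obtain ⟨𝒞, h⟩ := hG x p q u v
    obtain ⟨C, hC, huC, hvC, hsC⟩ := h.cover u (by simp) v (by simp) s hs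
    have hxC : x ∈ C.verts := by
      by_cases hu : u = x
      · rwa [← hu]
      · exact h.mem_of_nearDenseIn h1 h2 hC (by simp) (by simp) (hux hu) le_rfl le_rfl huC hsC
    refine ⟨𝒞, h.mono ?_, C, hC, hxC,
      h.mem_of_nearDenseIn h1 h2 hC (by simp) (by simp) hxp le_rfl le_rfl hxC hsC, hsC⟩
    intro z hz
    simp only [Set.mem_insert_iff, Set.mem_singleton_iff] at hz ⊢
    tauto

/-- Suppose `x ∈ X` is joined nearly densely in `[a, b]` to the rest of `X`, that `X` contains a
time-edge at one end of `[a, b]`, and that `xy` appears at the other end. Then all pairs in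
`X ∪ {y}` are nearly dense in `[a, b]`. -/
theorem LocallyCovered.nearDenseIn_insert (hG : G.LocallyCovered Δ₁ Δ₂) (h1 : 1 ≤ Δ₁)
    (h2 : Δ₁ < Δ₂) {X : Set V} {x y w w' : V} {a b s t : ℕ} (hab : a ≤ b)
    (hst : s = a ∧ t = b ∨ s = b ∧ t = a) (hw : w ∈ X) (hw' : w' ∈ X)
    (hs : s ∈ G.times s(w, w')) (ht : t ∈ G.times s(x, y))
    (hd : ∀ p ∈ X, x ≠ p → G.NearDenseIn Δ₁ s(x, p) a b) :
    ∀ p ∈ insert y X, ∀ q ∈ insert y X, p ≠ q → G.NearDenseIn Δ₁ s(p, q) a b := by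
  have hs' : s ∈ Set.Icc a b := ⟨by omega, by omega⟩
  have ht' : t ∈ Set.Icc a b := ⟨by omega, by omega⟩
  have hwx : w ≠ x → G.NearDenseIn Δ₁ s(w, x) s s := fun h => by
    rw [Sym2.eq_swap]
    exact (hd w hw h.symm).mono hs'.1 hs'.2
  have star : ∀ p ∈ X, x ≠ p →
      G.NearDenseIn Δ₁ s(x, y) a b ∧ (p ≠ y → G.NearDenseIn Δ₁ s(p, y) a b) := by
    intro p hp hxp
    obtain ⟨𝒞, h, C, hC, hxC, hpC, hsC⟩ :=
      hG.exists_template h1 h2 y ((hd p hp hxp).mono hs'.1 hs'.2) hs hwx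
    obtain ⟨D, hD, hxD, hyD, htD⟩ := h.cover x (by simp) y (by simp) t ht
    obtain rfl := h.eq_of_nearDenseIn h1 h2 (by simp) (by simp) (hd p hp hxp) hC hD hs' ht' hsC htD
      hxC hxD
    have ha : C.a ≤ a := by have := hsC.1; have := htD.1; omega
    have hb : b ≤ C.b := by have := hsC.2; have := htD.2; omega
    exact ⟨(h.dense C hC x hxC y hyD (ne_of_mem_times ht)).mono ha hb,
      fun hpy => (h.dense C hC p hpC y hyD hpy).mono ha hb⟩
  have hxy : G.NearDenseIn Δ₁ s(x, y) a b := by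
    by_cases h : w = x
    · exact (star w' hw' (h ▸ ne_of_mem_times hs)).1
    · exact (star w hw (Ne.symm h)).1
  have hpy : ∀ p ∈ X, p ≠ y → G.NearDenseIn Δ₁ s(p, y) a b := by
    intro p hp hne
    by_cases h : x = p
    · exact h ▸ hxy
    · exact (star p hp h).2 hne
  -- The two ends may need different covers of `{x, p, q}`, which `nearDenseIn_of_two` combines.
  have hpq : ∀ p ∈ X, ∀ q ∈ X, x ≠ p → x ≠ q → p ≠ q → G.NearDenseIn Δ₁ s(p, q) a b := by
    intro p hp q hq hxp hxq hpq
    have hdp := hd p hp hxp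
    have hdq := hd q hq hxq
    obtain ⟨𝒞, h, C, hC, hxC, hpC, hsC⟩ :=
      hG.exists_template h1 h2 q (hdp.mono hs'.1 hs'.2) hs hwx
    have hqC := h.mem_of_nearDenseIn h1 h2 hC (by simp) (by simp) hdq hs'.1 hs'.2 hxC hsC
    obtain ⟨𝒞', h', C', hC', hxC', hpC', htC'⟩ :=
      hG.exists_template h1 h2 q (hdp.mono ht'.1 ht'.2) ht (fun h => (h rfl).elim)
    have hqC' := h'.mem_of_nearDenseIn h1 h2 hC' (by simp) (by simp) hdq ht'.1 ht'.2 hxC' htC'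
    rcases hst with ⟨rfl, rfl⟩ | ⟨rfl, rfl⟩
    · exact h.nearDenseIn_of_two h' h1 h2 (by simp) (by simp) (by simp) (by simp) (by simp) hpq
        hdp hC hC' hxC hpC hqC hxC' hpC' hqC' hsC htC'
    · exact h'.nearDenseIn_of_two h h1 h2 (by simp) (by simp) (by simp) (by simp) (by simp) hpq
        hdp hC' hC hxC' hpC' hqC' hxC hpC hqC htC' hsC
  rintro p (rfl | hp) q (rfl | hq) hne
  · exact (hne rfl).elim
  · rw [Sym2.eq_swap]
    exact hpy q hq hne.symm
  · exact hpy p hp hne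
  · by_cases hp' : x = p
    · subst hp'
      exact hd q hq hne
    · by_cases hq' : x = q
      · subst hq'
        rw [Sym2.eq_swap]
        exact hd p hp hne.symm
      · exact hpq p hp q hq hp' hq' hne

/-! ### Tight templates and absorption. -/

namespace IsTight

variable {C D : Template V}

theorem exists_ne (hC : G.IsTight Δ C) (x : V) : ∃ p ∈ C.verts, x ≠ p := by
  obtain ⟨w, hw, w', hw', h⟩ := hC.left
  by_cases hx : x = w
  · exact ⟨w', hw', hx ▸ ne_of_mem_times h⟩
  · exact ⟨w, hw, hx⟩

/-- At a time-edge of a tight template, the cover of a triple has a template containing this time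
and any two vertices of the tight template. -/
theorem exists_template (hC : G.IsTight Δ₁ C) (hG : G.LocallyCovered Δ₁ Δ₂) (h1 : 1 ≤ Δ₁)
    (h2 : Δ₁ < Δ₂) {x p : V} (q : V) {s : ℕ} (hx : x ∈ C.verts) (hp : p ∈ C.verts) (hxp : x ≠ p)
    (hsC : s ∈ Set.Icc C.a C.b) (hs : ∃ w ∈ C.verts, ∃ w' ∈ C.verts, s ∈ G.times s(w, w')) :
    ∃ 𝒞, G.IsCover Δ₁ Δ₂ {x, p, q} 𝒞 ∧
      ∃ D ∈ 𝒞, x ∈ D.verts ∧ p ∈ D.verts ∧ s ∈ Set.Icc D.a D.b := by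
  obtain ⟨w, hw, w', hw', hs⟩ := hs
  exact hG.exists_template h1 h2 q ((hC.dense x hx p hp hxp).mono hsC.1 hsC.2) hs
    fun hne => (hC.dense w hw x hx hne).mono hsC.1 hsC.2

/-- The extension of a tight template by a vertex `y` joined to it at a time `t` of its interval
has nearly dense pairs. -/
theorem nearDenseIn_insert (hC : G.IsTight Δ₁ C) (hG : G.LocallyCovered Δ₁ Δ₂) (h1 : 1 ≤ Δ₁)
    (h2 : Δ₁ < Δ₂) {x y : V} {t : ℕ} (hx : x ∈ C.verts) (ht : t ∈ G.times s(x, y))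
    (htC : t ∈ Set.Icc C.a C.b) :
    ∀ p ∈ insert y C.verts, ∀ q ∈ insert y C.verts, p ≠ q →
      G.NearDenseIn Δ₁ s(p, q) C.a C.b := by
  have star : ∀ p ∈ C.verts, x ≠ p →
      G.NearDenseIn Δ₁ s(x, y) C.a C.b ∧ (p ≠ y → G.NearDenseIn Δ₁ s(p, y) C.a C.b) := by
    intro p hp hxp
    have hd := hC.dense x hx p hp hxp
    have key : ∀ s ∈ Set.Icc C.a C.b,
        (∃ w ∈ C.verts, ∃ w' ∈ C.verts, s ∈ G.times s(w, w')) →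
        ∃ 𝒞, G.IsCover Δ₁ Δ₂ {x, p, y} 𝒞 ∧
          ∃ D ∈ 𝒞, x ∈ D.verts ∧ p ∈ D.verts ∧ y ∈ D.verts ∧ s ∈ Set.Icc D.a D.b := by
      intro s hs hw
      obtain ⟨𝒞, h, D, hD, hxD, hpD, hsD⟩ := hC.exists_template hG h1 h2 y hx hp hxp hs hw
      obtain ⟨E, hE, hxE, hyE, htE⟩ := h.cover x (by simp) y (by simp) t ht
      obtain rfl := h.eq_of_nearDenseIn h1 h2 (by simp) (by simp) hd hD hE hs htC hsD htE hxD hxE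
      exact ⟨𝒞, h, D, hD, hxD, hpD, hyE, hsD⟩
    obtain ⟨𝒞, h, D, hD, hxD, hpD, hyD, hsD⟩ := key C.a ⟨le_rfl, C.a_le_b⟩ hC.left
    obtain ⟨𝒞', h', D', hD', hxD', hpD', hyD', hsD'⟩ := key C.b ⟨C.a_le_b, le_rfl⟩ hC.right
    refine ⟨?_, fun hpy => ?_⟩
    -- The pair `xy` is handled with `p` as pivot, through the nearly dense pair `px`.
    · exact h.nearDenseIn_of_two h' h1 h2 (x := p) (by simp) (by simp) (by simp) (by simp)
        (by simp) (ne_of_mem_times ht) (by rwa [Sym2.eq_swap]) hD hD' hpD hxD hyD hpD' hxD' hyD'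
        hsD hsD'
    · exact h.nearDenseIn_of_two h' h1 h2 (x := x) (by simp) (by simp) (by simp) (by simp)
        (by simp) hpy hd hD hD' hxD hpD hyD hxD' hpD' hyD' hsD hsD'
  have hpy : ∀ p ∈ C.verts, p ≠ y → G.NearDenseIn Δ₁ s(p, y) C.a C.b := by
    intro p hp hne
    by_cases h : x = p
    · obtain ⟨q, hq, hxq⟩ := hC.exists_ne x
      exact h ▸ (star q hq hxq).1
    · exact (star p hp h).2 hne
  rintro p (rfl | hp) q (rfl | hq) hne
  · exact (hne rfl).elim
  · rw [Sym2.eq_swap]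
    exact hpy q hq hne.symm
  · exact hpy p hp hne
  · exact hC.dense p hp q hq hne

/-- A tight template can be extended by every incident time-edge less than `Δ₂` away from it. -/
theorem extend (hC : G.IsTight Δ₁ C) (hG : G.LocallyCovered Δ₁ Δ₂) (h1 : 1 ≤ Δ₁) (h2 : Δ₁ < Δ₂)
    {x y : V} {t : ℕ} (hx : x ∈ C.verts) (ht : t ∈ G.times s(x, y)) (hat : C.a < t + Δ₂)
    (htb : t < C.b + Δ₂) :
    G.IsTight Δ₁ ⟨insert y C.verts, min C.a t, max C.b t, by have := C.a_le_b; omega⟩ := by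
  have hab := C.a_le_b
  have hleft : ∃ p ∈ insert y C.verts, ∃ q ∈ insert y C.verts, C.a ∈ G.times s(p, q) :=
    hC.left.imp fun p ⟨hp, q, hq, h⟩ => ⟨Or.inr hp, q, Or.inr hq, h⟩
  have hright : ∃ p ∈ insert y C.verts, ∃ q ∈ insert y C.verts, C.b ∈ G.times s(p, q) :=
    hC.right.imp fun p ⟨hp, q, hq, h⟩ => ⟨Or.inr hp, q, Or.inr hq, h⟩
  have hnew : ∃ p ∈ insert y C.verts, ∃ q ∈ insert y C.verts, t ∈ G.times s(p, q) :=
    ⟨x, Or.inr hx, y, Or.inl rfl, ht⟩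
  refine ⟨?_, ?_, ?_⟩
  · rcases min_choice C.a t with h | h
    · simpa only [h] using hleft
    · simpa only [h] using hnew
  · rcases max_choice C.b t with h | h
    · simpa only [h] using hright
    · simpa only [h] using hnew
  -- For `t` outside the interval, covers anchored at the nearer end stretch the pairs at `x` to
  -- `t`; a time-edge at the far end then anchors the insertion of `y`.
  rcases lt_or_ge t C.a with hta | hta
  · simp only [min_eq_right hta.le, max_eq_left (hta.le.trans hab)]
    obtain ⟨w, hw, w', hw', hs⟩ := hC.right
    refine hG.nearDenseIn_insert h1 h2 (hta.le.trans hab) (Or.inr ⟨rfl, rfl⟩) hw hw' hs ht ?_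
    intro p hp hxp
    obtain ⟨𝒞, h, D, hD, hxD, hpD, haD⟩ :=
      hC.exists_template hG h1 h2 y hx hp hxp ⟨le_rfl, hab⟩ hC.left
    exact h.extend_left h2 (by simp) (by simp) hxp (hC.dense x hx p hp hxp) hD hxD hpD haD
      (h.mem_of_close hD (by simp) (by simp) hxD haD ht hat (by omega)).2
  rcases lt_or_ge C.b t with hbt | hbt
  · simp only [min_eq_left hta, max_eq_right hbt.le]
    obtain ⟨w, hw, w', hw', hs⟩ := hC.left
    refine hG.nearDenseIn_insert h1 h2 hta (Or.inl ⟨rfl, rfl⟩) hw hw' hs ht ?_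
    intro p hp hxp
    obtain ⟨𝒞, h, D, hD, hxD, hpD, hbD⟩ :=
      hC.exists_template hG h1 h2 y hx hp hxp ⟨hab, le_rfl⟩ hC.right
    exact h.extend_right h2 (by simp) (by simp) hxp (hC.dense x hx p hp hxp) hD hxD hpD hbD
      (h.mem_of_close hD (by simp) (by simp) hxD hbD ht (by omega) htb).2
  · simp only [min_eq_left hta, max_eq_left hbt]
    exact hC.nearDenseIn_insert hG h1 h2 hx ht ⟨hta, hbt⟩

end IsTight

/-! ### Maximal tight templates. -/

theorem bddAbove_times (G : TemporalGraph V) : BddAbove {t | ∃ e, t ∈ G.times e} := by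
  obtain ⟨T, hT⟩ := G.finite_lifetime
  exact ⟨T, fun t ⟨e, ht⟩ => hT e t ht⟩

/-- A tight template that no other tight template contains. -/
structure IsMaxTight (G : TemporalGraph V) (Δ : ℕ) (C : Template V) : Prop extends
    G.IsTight Δ C where
  eq_of_le : ∀ D, G.IsTight Δ D → C.verts ⊆ D.verts → D.a ≤ C.a → C.b ≤ D.b → D = C

theorem finite_isTight [Finite V] (G : TemporalGraph V) (Δ : ℕ) : {C | G.IsTight Δ C}.Finite := by
  have hfin : (Set.univ ×ˢ Set.Iic G.lifetime ×ˢ Set.Iic G.lifetime :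
      Set (Set V × ℕ × ℕ)).Finite :=
    Set.finite_univ.prod ((Set.finite_Iic _).prod (Set.finite_Iic _))
  refine Set.Finite.of_finite_image (f := fun C : Template V => (C.verts, C.a, C.b))
    (hfin.subset ?_) ?_
  · rintro _ ⟨C, hC, rfl⟩
    obtain ⟨x, -, y, -, h⟩ := hC.right
    have hb : C.b ≤ G.lifetime := le_csSup G.bddAbove_times ⟨_, h⟩
    exact ⟨trivial, C.a_le_b.trans hb, hb⟩
  · intro C _ D _ h
    simp only [Prod.mk.injEq] at h
    exact Template.ext h.1 h.2.1 h.2.2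

theorem IsTight.exists_isMaxTight [Finite V] {C : Template V} (hC : G.IsTight Δ C) :
    ∃ D, G.IsMaxTight Δ D ∧ C.verts ⊆ D.verts ∧ D.a ≤ C.a ∧ C.b ≤ D.b := by
  obtain ⟨D, ⟨hD, hCD, ha, hb⟩, hmax⟩ := Set.Finite.exists_maximalFor
    (fun D : Template V => D.verts.ncard + (D.b - D.a))
    {D | G.IsTight Δ D ∧ C.verts ⊆ D.verts ∧ D.a ≤ C.a ∧ C.b ≤ D.b}
    ((G.finite_isTight Δ).subset fun D hD => hD.1) ⟨C, hC, subset_rfl, le_rfl, le_rfl⟩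
  refine ⟨D, ⟨hD, fun E hE hDE ha' hb' => ?_⟩, hCD, ha, hb⟩
  have hle := @hmax E ⟨hE, hCD.trans hDE, ha'.trans ha, hb.trans hb'⟩
  have hcard := Set.ncard_le_ncard hDE (Set.toFinite _)
  have := D.a_le_b
  have := E.a_le_b
  simp only at hle
  have hle' := hle (by omega)
  have hverts : D.verts = E.verts :=
    Set.eq_of_subset_of_ncard_le hDE (by omega) (Set.toFinite _)
  exact Template.ext hverts.symm (by omega) (by omega)

theorem isTight_of_mem_times {x y : V} {t : ℕ} (hΔ : 1 ≤ Δ) (ht : t ∈ G.times s(x, y)) :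
    G.IsTight Δ ⟨{x, y}, t, t, le_rfl⟩ := by
  have h : ∃ p ∈ ({x, y} : Set V), ∃ q ∈ ({x, y} : Set V), t ∈ G.times s(p, q) :=
    ⟨x, by simp, y, by simp, ht⟩
  refine ⟨h, h, ?_⟩
  have hd : G.NearDenseIn Δ s(x, y) t t := fun u w hu huw hw hlt =>
    ⟨t, ht, by omega, by omega⟩
  rintro p (rfl | rfl) q (rfl | rfl) hne
  · exact (hne rfl).elim
  · exact hd
  · rwa [Sym2.eq_swap]
  · exact (hne rfl).elim

namespace IsMaxTight

variable {C D : Template V}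

/-- Time-edges that are incident with a maximal tight template and less than `Δ₂` away from it
belong to it. -/
theorem mem_of_close (hC : G.IsMaxTight Δ₁ C) (hG : G.LocallyCovered Δ₁ Δ₂) (h1 : 1 ≤ Δ₁)
    (h2 : Δ₁ < Δ₂) {x y : V} {t : ℕ} (hx : x ∈ C.verts) (ht : t ∈ G.times s(x, y))
    (hat : C.a < t + Δ₂) (htb : t < C.b + Δ₂) : y ∈ C.verts ∧ t ∈ Set.Icc C.a C.b := by
  have h := hC.eq_of_le _ (hC.toIsTight.extend hG h1 h2 hx ht hat htb) (Set.subset_insert _ _)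
    (min_le_left _ _) (le_max_left _ _)
  have hv := congrArg Template.verts h
  have ha := congrArg Template.a h
  have hb := congrArg Template.b h
  simp only at hv ha hb
  exact ⟨hv ▸ Set.mem_insert _ _, by omega, by omega⟩

theorem denseIn (hC : G.IsMaxTight Δ₁ C) (hG : G.LocallyCovered Δ₁ Δ₂) (h1 : 1 ≤ Δ₁)
    (h2 : Δ₁ < Δ₂) {x y : V} (hx : x ∈ C.verts) (hy : y ∈ C.verts) (hxy : x ≠ y) :
    G.DenseIn Δ₁ s(x, y) C.a C.b := by
  have hab := C.a_le_b
  rintro τ ⟨hτ1, hτ2⟩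
  rcases le_or_gt (τ + Δ₁) (C.b + 1) with h | h
  · obtain ⟨t, ht, ht1, ht2⟩ := hC.dense x hx y hy hxy τ (τ + Δ₁ - 1) hτ1 (by omega) (by omega)
      (by omega)
    exact ⟨t, ht, by omega, by omega⟩
  -- The interval is shorter than `Δ₁` and `τ = C.a`. Near density alone would allow `t < C.a`;
  -- absorption excludes it.
  · obtain ⟨t, ht, ht1, ht2⟩ := hC.dense x hx y hy hxy C.a C.b le_rfl hab le_rfl (by omega)
    have := (hC.mem_of_close hG h1 h2 hx ht (by omega) (by omega)).2.1
    exact ⟨t, ht, by omega, by omega⟩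

/-- Maximal tight templates with a common vertex and intersecting intervals coincide. -/
theorem eq_of_mem (hC : G.IsMaxTight Δ₁ C) (hD : G.IsMaxTight Δ₁ D)
    (hG : G.LocallyCovered Δ₁ Δ₂) (h1 : 1 ≤ Δ₁) (h2 : Δ₁ < Δ₂) {v : V} (hvC : v ∈ C.verts)
    (hvD : v ∈ D.verts) (h : D.a ∈ Set.Icc C.a C.b) : C = D := by
  have hab := D.a_le_b
  obtain ⟨ha, hb⟩ := h
  have hsub : D.verts ⊆ C.verts := by
    intro y hy
    by_cases hvy : v = y
    · exact hvy ▸ hvC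
    obtain ⟨t, ht, ht1, ht2⟩ := (hD.dense v hvD y hy hvy).exists_near h1 le_rfl hab
    exact (hC.mem_of_close hG h1 h2 hvC ht (by omega) (by omega)).1
  refine hD.eq_of_le C hC.toIsTight hsub ha ?_
  by_contra! hlt
  obtain ⟨x, hx, y, hy, hxy⟩ := hD.right
  rcases lt_or_ge D.b (C.b + Δ₂) with hlt' | hge
  · have := (hC.mem_of_close hG h1 h2 (hsub hx) hxy (by omega) hlt').2.2
    omega
  · obtain ⟨t, ht, ht1, ht2⟩ := hD.dense x hx y hy (ne_of_mem_times hxy) (C.b + 1) (C.b + Δ₁)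
      (by omega) (by omega) (by omega) (by omega)
    have := (hC.mem_of_close hG h1 h2 (hsub hx) ht (by omega) (by omega)).2.2
    omega

/-- A tight template starting after the end of a maximal tight template with a common vertex starts
at least `Δ₂` later. -/
theorem add_le_of_lt (hC : G.IsMaxTight Δ₁ C) (hD : G.IsTight Δ₁ D)
    (hG : G.LocallyCovered Δ₁ Δ₂) (h1 : 1 ≤ Δ₁) (h2 : Δ₁ < Δ₂) {v : V} (hvC : v ∈ C.verts)
    (hvD : v ∈ D.verts) (hlt : C.b < D.a) : C.b + Δ₂ ≤ D.a := by
  by_contra! hclose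
  have habC := C.a_le_b
  have habD := D.a_le_b
  rcases id hG with ⟨rfl, -⟩ | hG'
  · obtain ⟨y, hy, hvy⟩ := hD.exists_ne v
    obtain ⟨t, ht, ht1, ht2⟩ := (hD.dense v hvD y hy hvy).exists_near le_rfl le_rfl habD
    have := (hC.mem_of_close hG h1 h2 hvC ht (by omega) (by omega)).2.2
    omega
  obtain ⟨x, hx, x', hx', hxb⟩ := hC.right
  obtain ⟨y, hy, y', hy', hya⟩ := hD.left
  have hyC : y ∉ C.verts := fun hyC => by
    have := (hC.mem_of_close hG h1 h2 hyC hya (by omega) (by omega)).2.2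
    omega
  -- In this cover the templates at `C.b` and at `D.a` both contain `v`, hence coincide. Then `xy`
  -- appears near `C.b`, and `C` would absorb `y`.
  obtain ⟨𝒞, h⟩ := hG' v x x' y y'
  obtain ⟨E, hE, hxE, -, hbE⟩ := h.cover x (by simp) x' (by simp) _ hxb
  obtain ⟨F, hF, hyF, -, haF⟩ := h.cover y (by simp) y' (by simp) _ hya
  have hvE : v ∈ E.verts := by
    by_cases hxv : x = v
    · exact hxv ▸ hxE
    · exact h.mem_of_nearDenseIn h1 h2 hE (by simp) (by simp) (hC.dense x hx v hvC hxv) habC le_rfl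
        hxE hbE
  have hvF : v ∈ F.verts := by
    by_cases hyv : y = v
    · exact hyv ▸ hyF
    · exact h.mem_of_nearDenseIn h1 h2 hF (by simp) (by simp) (hD.dense y hy v hvD hyv) le_rfl habD
        hyF haF
  obtain rfl := h.unique E hE F hF v _ _ hvE hvF hbE haF (by omega) (by omega)
  have hxy : x ≠ y := fun hxy => hyC (hxy ▸ hx)
  obtain ⟨t, ht, ht1, ht2⟩ := (h.dense E hE x hxE y hyF hxy).exists_near h1 hbE.1 hbE.2
  exact hyC (hC.mem_of_close hG h1 h2 hx ht (by omega) (by omega)).1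

theorem independent (hC : G.IsMaxTight Δ₁ C) (hD : G.IsMaxTight Δ₁ D)
    (hG : G.LocallyCovered Δ₁ Δ₂) (h1 : 1 ≤ Δ₁) (h2 : Δ₁ < Δ₂) (hne : C ≠ D) :
    C.Independent Δ₂ D := by
  rcases Set.eq_empty_or_nonempty (C.verts ∩ D.verts) with h | ⟨v, hvC, hvD⟩
  · exact Or.inl h
  right
  rintro s ⟨hs1, hs2⟩ t ⟨ht1, ht2⟩
  rw [le_abs]
  rcases lt_or_ge C.b D.a with h | h
  · have := hC.add_le_of_lt hD.toIsTight hG h1 h2 hvC hvD h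
    omega
  rcases lt_or_ge D.b C.a with h' | h'
  · have := hD.add_le_of_lt hC.toIsTight hG h1 h2 hvD hvC h'
    omega
  rcases le_total C.a D.a with hle | hle
  · exact (hne (hC.eq_of_mem hD hG h1 h2 hvC hvD ⟨hle, h⟩)).elim
  · exact (hne (hD.eq_of_mem hC hG h1 h2 hvD hvC ⟨hle, h'⟩).symm).elim

end IsMaxTight

theorem LocallyCovered.isCluster [Finite V] (hG : G.LocallyCovered Δ₁ Δ₂) (h1 : 1 ≤ Δ₁)
    (h2 : Δ₁ < Δ₂) : G.IsCluster Δ₁ Δ₂ := by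
  refine ⟨{C | G.IsMaxTight Δ₁ C},
    ⟨(G.finite_isTight Δ₁).subset fun C hC => hC.toIsTight,
      fun C hC D hD hne => hC.independent hD hG h1 h2 hne, fun C hC => ⟨?_, ?_⟩⟩,
    fun x y t ht => ?_, fun C hC x hx y hy hxy => hC.denseIn hG h1 h2 hx hy hxy⟩
  · obtain ⟨x, -, y, -, h⟩ := hC.left
    exact G.times_pos _ _ h
  · obtain ⟨x, -, y, -, h⟩ := hC.right
    exact le_csSup G.bddAbove_times ⟨_, h⟩
  · obtain ⟨C, hC, hv, ha, hb⟩ := (isTight_of_mem_times h1 ht).exists_isMaxTight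
    exact ⟨C, hC, hv (by simp), hv (by simp), ha, hb⟩

/-! ### Cluster temporal graphs, covers and induced subgraphs. -/

theorem _root_.Template.Independent.eq_of_pairwise
    (h : 𝒞.Pairwise (Template.Independent Δ₂)) {C D : Template V} (hC : C ∈ 𝒞) (hD : D ∈ 𝒞)
    {v : V} {s t : ℕ} (hvC : v ∈ C.verts) (hvD : v ∈ D.verts) (hs : s ∈ Set.Icc C.a C.b)
    (ht : t ∈ Set.Icc D.a D.b) (hst : s < t + Δ₂) (hts : t < s + Δ₂) : C = D := by
  by_contra hne
  rcases h hC hD hne with h | h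
  · exact (h ▸ (⟨hvC, hvD⟩ : v ∈ C.verts ∩ D.verts) : v ∈ (∅ : Set V))
  · rcases le_abs.1 (h s hs t ht) with h | h <;> omega

/-- A cluster temporal graph has a cover of its whole vertex set. -/
theorem IsCluster.exists_isCover (h : G.IsCluster Δ₁ Δ₂) :
    ∃ 𝒞, G.IsCover Δ₁ Δ₂ Set.univ 𝒞 := by
  obtain ⟨𝒞, ⟨-, hind, -⟩, hcov, hdense⟩ := h
  exact ⟨𝒞, fun C hC D hD v s t => Template.Independent.eq_of_pairwise hind hC hD,
    fun x _ y _ t => hcov x y t,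
    fun C hC x hx y hy hxy => (hdense C hC x hx y hy hxy).nearDenseIn⟩

/-- Covers of `G[S]` give covers of `S` in `G`. -/
theorem IsCover.map {𝒞 : Set (Template S)} (h : (G.induce S).IsCover Δ₁ Δ₂ Set.univ 𝒞) :
    G.IsCover Δ₁ Δ₂ S ((fun C => ⟨Subtype.val '' C.verts, C.a, C.b, C.a_le_b⟩) '' 𝒞) := by
  refine ⟨?_, ?_, ?_⟩
  · rintro _ ⟨C, hC, rfl⟩ _ ⟨D, hD, rfl⟩ _ s t ⟨v, hvC, rfl⟩ ⟨v', hvD, hvv⟩ hs ht hst hts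
    obtain rfl := Subtype.ext hvv
    rw [h.unique C hC D hD v' s t hvC hvD hs ht hst hts]
  · intro x hx y hy t ht
    obtain ⟨C, hC, hxC, hyC, htC⟩ := h.cover ⟨x, hx⟩ trivial ⟨y, hy⟩ trivial t ht
    exact ⟨_, ⟨C, hC, rfl⟩, ⟨_, hxC, rfl⟩, ⟨_, hyC, rfl⟩, htC⟩
  · rintro _ ⟨C, hC, rfl⟩ _ ⟨x, hx, rfl⟩ _ ⟨y, hy, rfl⟩ hxy
    exact h.dense C hC x hx y hy (fun h => hxy (h ▸ rfl))

/-- Covers of `S` in `G` give covers of `G[S]`. -/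
theorem IsCover.comap (h : G.IsCover Δ₁ Δ₂ S 𝒞) :
    (G.induce S).IsCover Δ₁ Δ₂ Set.univ
      ((fun C => ⟨Subtype.val ⁻¹' C.verts, C.a, C.b, C.a_le_b⟩) '' 𝒞) := by
  refine ⟨?_, ?_, ?_⟩
  · rintro _ ⟨C, hC, rfl⟩ _ ⟨D, hD, rfl⟩ v s t hvC hvD hs ht hst hts
    rw [h.unique C hC D hD v s t hvC hvD hs ht hst hts]
  · intro x _ y _ t ht
    obtain ⟨C, hC, hxC, hyC, htC⟩ := h.cover x x.2 y y.2 t ht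
    exact ⟨_, ⟨C, hC, rfl⟩, hxC, hyC, htC⟩
  · rintro _ ⟨C, hC, rfl⟩ x hx y hy hxy
    exact h.dense C hC x hx y hy (fun h => hxy (Subtype.ext h))

/-- Restricted templates may outlast the lifetime of `G[S]` or lose density, but they still form a
cover, from which sufficiency on `G[S]` builds a valid collection. -/
theorem IsCluster.induce [Finite V] (h : G.IsCluster Δ₁ Δ₂) (h1 : 1 ≤ Δ₁) (h2 : Δ₁ < Δ₂)
    (S : Set V) : (G.induce S).IsCluster Δ₁ Δ₂ := by
  obtain ⟨𝒞, h⟩ := h.exists_isCover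
  have h' := (h.mono (Set.subset_univ S)).comap
  exact LocallyCovered.isCluster
    (Or.inr fun x y z u v => ⟨_, h'.mono (Set.subset_univ _)⟩) h1 h2

theorem IsCluster.exists_isCover_of_induce (h : (G.induce S).IsCluster Δ₁ Δ₂) :
    ∃ 𝒞, G.IsCover Δ₁ Δ₂ S 𝒞 :=
  let ⟨_, h⟩ := h.exists_isCover
  ⟨_, h.map⟩

end TemporalGraph

theorem theorem5p1 {V : Type*} [Finite V] (G : TemporalGraph V) (Δ₁ Δ₂ : ℕ)
    (hΔ₁ : 1 ≤ Δ₁) (hΔ₂ : Δ₁ < Δ₂) :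
    (Δ₁ = 1 →
      (G.IsCluster 1 Δ₂ ↔
        ∀ S : Finset V, S.card ≤ 3 → (G.induce (S : Set V)).IsCluster 1 Δ₂)) ∧
    (1 < Δ₁ →
      (G.IsCluster Δ₁ Δ₂ ↔
        ∀ S : Finset V, S.card ≤ 5 → (G.induce (S : Set V)).IsCluster Δ₁ Δ₂)) := by
  classical
  constructor
  · rintro rfl
    refine ⟨fun h S _ => h.induce le_rfl hΔ₂ _, fun h =>
      TemporalGraph.LocallyCovered.isCluster (Or.inl ⟨rfl, fun x y z => ?_⟩) le_rfl hΔ₂⟩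
    have := (h {x, y, z} Finset.card_le_three).exists_isCover_of_induce
    simpa using this
  · intro _
    refine ⟨fun h S _ => h.induce hΔ₁ hΔ₂ _, fun h =>
      TemporalGraph.LocallyCovered.isCluster (Or.inr fun x y z u v => ?_) hΔ₁ hΔ₂⟩
    have := (h {x, y, z, u, v} Finset.card_le_five).exists_isCover_of_induce
    simpa using this
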